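/- For permutations $\tau\in S_m$ and $\sigma\in S_n$, an occurrence of $\tau$ in $\sigma$ is an $m$-element set of positions on which the values of $\sigma$ are in the same relative order as the values of $\tau$. Let $g(\tau,\sigma)$ be the number of occurrences of $\tau$ in $\sigma$, let $g(\tau,n)=\max_{\sigma\in S_n}g(\tau,\sigma)$, and let the packing density of $\tau$ be $\rho(\tau)=\lim_{n\to\infty} g(\tau,n)/\binom{n}{m}$. Let $\alpha\ge 2$ be an integer, and let $\tau_{\alpha,\alpha}\in S_{2\alpha}$ be the pattern with one-line notation $[1,2,\dots,\alpha,2\alpha,2\alpha-1,\dots,\alpha+1]$. Then the limit defining $\rho(\tau_{\alpha,\alpha})$ exists, and $$\rho(\tau_{\alpha,\alpha})=\frac{\binom{2\alpha}{\alpha}}{2^{2\alpha}}.$$ Moreover, $g(\tau_{\alpha,\alpha},2n)=\binom{n}{\alpha}^2$ for every $n\ge 0$, and $$\rho(\tau_{\alpha,\alpha})=\lim_{n\to\infty}\frac{\binom{n}{\alpha}^2}{\binom{2n}{2\alpha}}.$$ -/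

import Mathlib

open Filter Topology

namespace PatternPacking

/-- `S` is an occurrence of the pattern `τ` (of length `m`) in the permutation `σ` (of length `n`):
`S` is a set of `m` positions and, listing them in increasing order, the values of `σ` at these
positions are in the same relative order as the values of `τ`. -/
def IsOccurrence {m n : ℕ} (τ : Equiv.Perm (Fin m)) (σ : Equiv.Perm (Fin n))
    (S : Finset (Fin n)) : Prop :=
  ∃ h : S.card = m, ∀ i j : Fin m,
    σ (S.orderEmbOfFin h i) < σ (S.orderEmbOfFin h j) ↔ τ i < τ j

open Classical in
/-- The number `g(τ, σ)` of occurrences of `τ` in `σ`. -/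
noncomputable def occ {m n : ℕ} (τ : Equiv.Perm (Fin m)) (σ : Equiv.Perm (Fin n)) : ℕ :=
  (Finset.univ.filter fun S : Finset (Fin n) => IsOccurrence τ σ S).card

/-- The largest number `g(τ, n)` of occurrences of `τ` in a permutation of length `n`. -/
noncomputable def maxOcc {m : ℕ} (τ : Equiv.Perm (Fin m)) (n : ℕ) : ℕ :=
  Finset.univ.sup fun σ : Equiv.Perm (Fin n) => occ τ σ

/-- The largest proportion `g(τ, n) / C(n, m)` of `m`-subsets that are occurrences of `τ`. -/
noncomputable def packingRatio {m : ℕ} (τ : Equiv.Perm (Fin m)) (n : ℕ) : ℝ :=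
  (maxOcc τ n : ℝ) / (n.choose m : ℝ)

/-- The packing density `ρ(τ)`: the limit of `g(τ, n) / C(n, m)` as `n → ∞`. -/
noncomputable def packingDensity {m : ℕ} (τ : Equiv.Perm (Fin m)) : ℝ :=
  limUnder atTop (packingRatio τ)

/-- The layered pattern `τ_{α,β} = [1, 2, …, α, α+β, α+β-1, …, α+1]`, with `α` layers of size `1`
followed by one layer of size `β` (positions and values are counted from `0`). -/
def tau (α β : ℕ) : Equiv.Perm (Fin (α + β)) :=
  finSumFinEquiv.permCongr (Equiv.sumCongr (Equiv.refl (Fin α)) Fin.revPerm)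

theorem tau_castAdd (α β : ℕ) (i : Fin α) :
    tau α β (Fin.castAdd β i) = Fin.castAdd β i := by
  simp [tau, Equiv.permCongr_apply]

theorem tau_natAdd (α β : ℕ) (i : Fin β) :
    tau α β (Fin.natAdd α i) = Fin.natAdd α i.rev := by
  simp [tau, Equiv.permCongr_apply]

end PatternPacking

/-! ### Counting in layered orders -/

namespace PatternPacking

/-! Order the positions of `σ` by `i < j ∧ σ i < σ j`. An occurrence of `tau α α` is then an
`α`-chain lying below an `α`-antichain, so it is enough to bound the number of such pairs in this
order.

Zykov symmetrization (`exists_chain_range_le`) replaces elements by clones of incomparable ones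
without lowering the count, until any two distinct labels are comparable. The order has then become
a stack of antichains, and `card_chainAntichainPairs_le` bounds the count by `layeredCount` of the
layer sizes.

Among stacks, `exists_layeredCount_le` reduces to `p` singleton layers below one layer of size `q`,
with count `p.choose α * q.choose α`. The product is largest when `p` and `q` are balanced. The
permutations `tau p q` attain it, so `maxOcc_tau` is exact for every `n`, and the density follows
from the asymptotics of binomial coefficients. -/

/-- The `k`-th elementary symmetric polynomial of the entries of a list. -/
def listEsymm : ℕ → List ℕ → ℕ
  | 0, _ => 1
  | _ + 1, [] => 0
  | k + 1, a :: L => listEsymm (k + 1) L + a * listEsymm k L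

/-- In a layered order whose layers, from bottom to top, have the sizes listed in `L`: the number
of `k`-element chains below a `β`-element antichain. -/
def layeredCount (β : ℕ) : ℕ → List ℕ → ℕ
  | _, [] => 0
  | 0, a :: L => a.choose β + layeredCount β 0 L
  | k + 1, a :: L => layeredCount β (k + 1) L + a * layeredCount β k L

/-- Pair a `k`-set of entries with one of the `r` ones. Either the one is already in the set (at
most `k` ways), or adding it gives a `(k+1)`-set of the same weight, reached at most `k + 1` times.
-/
theorem mul_listEsymm_replicate_append_le (r k : ℕ) (Z : List ℕ) :
    r * listEsymm k (List.replicate r 1 ++ Z) ≤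
      (k + 1) * listEsymm (k + 1) (List.replicate r 1 ++ Z) +
        k * listEsymm k (List.replicate r 1 ++ Z) := by
  induction r generalizing k with
  | zero => simp
  | succ r ih =>
    rw [List.replicate_succ, List.cons_append]
    cases k with
    | zero => simpa [listEsymm, add_mul] using ih 0
    | succ k =>
      have h₁ := ih (k + 1)
      have h₂ := ih k
      simp only [listEsymm]
      nlinarith

theorem layeredCount_append_pair (β k : ℕ) (X : List ℕ) (a b : ℕ) :
    layeredCount β (k + 1) (X ++ [a, b]) = layeredCount β (k + 1) X +
      listEsymm (k + 1) X * (a.choose β + b.choose β) + listEsymm k X * (a * b.choose β) := by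
  induction X generalizing k with
  | nil => cases k <;> simp [layeredCount, listEsymm]
  | cons c X ih =>
    cases k with
    | zero =>
      have h : ∀ Y : List ℕ, layeredCount β 0 (Y ++ [a, b]) =
          layeredCount β 0 Y + (a.choose β + b.choose β) := by
        intro Y
        induction Y with
        | nil => simp [layeredCount]
        | cons d Y ihY => simp [layeredCount, ihY]; ring
      simp only [List.cons_append, layeredCount, listEsymm, ih, h]
      ring
    | succ k =>
      simp only [List.cons_append, layeredCount, listEsymm, ih]
      ring

theorem layeredCount_zero_append (β : ℕ) (X Y : List ℕ) :
    layeredCount β 0 (X ++ Y) = layeredCount β 0 X + layeredCount β 0 Y := by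
  induction X with
  | nil => simp [layeredCount]
  | cons d X ih => simp [layeredCount, ih]; ring

theorem layeredCount_append_singleton (β k : ℕ) (X : List ℕ) (a : ℕ) :
    layeredCount β k (X ++ [a]) = layeredCount β k X + listEsymm k X * a.choose β := by
  induction X generalizing k with
  | nil => cases k <;> simp [layeredCount, listEsymm]
  | cons c X ih =>
    cases k <;> simp only [List.cons_append, layeredCount, listEsymm, ih] <;> ring

/-- The left side counts those `(k+2)`-subsets of a disjoint union that lie in one part or have
exactly one element in the first part. -/
theorem choose_add_choose_add_mul_le (a b k : ℕ) :
    a.choose (k + 2) + b.choose (k + 2) + a * b.choose (k + 1) ≤ (a + b).choose (k + 2) := by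
  have h₁ : ∀ j x y : ℕ, x.choose (j + 1) + y.choose (j + 1) ≤ (x + y).choose (j + 1) := by
    intro j x y
    induction x with
    | zero => simp
    | succ x ih =>
      have := Nat.choose_le_choose j (Nat.le_add_right x y)
      rw [Nat.add_right_comm, Nat.choose_succ_succ' x, Nat.choose_succ_succ' (x + y)]
      omega
  induction a with
  | zero => simp
  | succ a ih =>
    have := h₁ k a b
    rw [show a + 1 + b = a + b + 1 by ring, Nat.choose_succ_succ' a, Nat.choose_succ_succ' (a + b), add_mul]
    nlinarith

/-- Merging the two top layers does not decrease the count when the top one has no more elements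
than there are one-element layers at the bottom. -/
theorem layeredCount_merge_le (k r a b : ℕ) (hb : b ≤ r) (Z : List ℕ) :
    layeredCount (k + 2) (k + 2) (List.replicate r 1 ++ Z ++ [a, b]) ≤
      layeredCount (k + 2) (k + 2) (List.replicate r 1 ++ Z ++ [a + b]) := by
  rw [layeredCount_append_pair, layeredCount_append_singleton]
  have h₁ := mul_listEsymm_replicate_append_le r (k + 1) Z
  generalize List.replicate r 1 ++ Z = X at *
  have h₂ := choose_add_choose_add_mul_le a b k
  -- Merging loses the pairs whose chain ends in layer `a` and whose antichain lies in `b`; they are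
  -- repaid by antichains with one element in `a` and the rest in `b`. This is where `b ≤ r` enters.
  have h₃ : listEsymm (k + 1) X * b.choose (k + 2) ≤
      listEsymm (k + 2) X * b.choose (k + 1) := by
    have h₄ := Nat.choose_succ_right_eq b (k + 1)
    rcases Nat.lt_or_ge b (k + 1) with h | h
    · simp [Nat.choose_eq_zero_of_lt (show b < k + 2 by omega)]
    · obtain ⟨d, rfl⟩ := Nat.exists_eq_add_of_le h
      rw [Nat.add_sub_cancel_left] at h₄
      have h₅ : d * listEsymm (k + 1) X ≤ (k + 2) * listEsymm (k + 2) X := by nlinarith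
      refine Nat.le_of_mul_le_mul_left (c := k + 2) ?_ (by omega)
      calc (k + 2) * (listEsymm (k + 1) X * (k + 1 + d).choose (k + 2))
          = (d * listEsymm (k + 1) X) * (k + 1 + d).choose (k + 1) := by
            linear_combination listEsymm (k + 1) X * h₄
        _ ≤ ((k + 2) * listEsymm (k + 2) X) * (k + 1 + d).choose (k + 1) :=
            Nat.mul_le_mul_right _ h₅
        _ = _ := by ring
  calc _ = layeredCount (k + 2) (k + 2) X + (listEsymm (k + 2) X *
          (a.choose (k + 2) + b.choose (k + 2)) +
            a * (listEsymm (k + 1) X * b.choose (k + 2))) := by ring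
    _ ≤ layeredCount (k + 2) (k + 2) X + (listEsymm (k + 2) X *
          (a.choose (k + 2) + b.choose (k + 2)) +
            a * (listEsymm (k + 2) X * b.choose (k + 1))) := by gcongr
    _ = layeredCount (k + 2) (k + 2) X + listEsymm (k + 2) X *
          (a.choose (k + 2) + b.choose (k + 2) + a * b.choose (k + 1)) := by ring
    _ ≤ _ := by gcongr

/-- As `β ≥ 2`, no antichain fits in a singleton layer, so only the chain is divided between the
singletons and `M`. -/
theorem layeredCount_replicate_append {β : ℕ} (hβ : 2 ≤ β) (r k : ℕ) (M : List ℕ) :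
    layeredCount β k (List.replicate r 1 ++ M) =
      ∑ ij ∈ Finset.HasAntidiagonal.antidiagonal k, r.choose ij.1 * layeredCount β ij.2 M := by
  have h1 : Nat.choose 1 β = 0 := Nat.choose_eq_zero_of_lt hβ
  induction r generalizing k with
  | zero =>
    cases k with
    | zero => simp
    | succ k => simp [Finset.Nat.antidiagonal_succ]
  | succ r ih =>
    rw [List.replicate_succ, List.cons_append]
    cases k with
    | zero => simp [layeredCount, ih, h1]
    | succ k =>
      simp only [layeredCount, ih, Finset.Nat.antidiagonal_succ, Finset.sum_cons,
        Finset.sum_map, Function.Embedding.prodMap, Function.Embedding.coeFn_mk, Prod.map,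
        Nat.choose_succ_succ, Nat.choose_zero_right, Function.Embedding.refl_apply,
        Nat.succ_eq_add_one, add_mul, Finset.sum_add_distrib]
      ring

/-- Splitting a layer that follows `r` one-element layers into one-element layers does not decrease
the count when there are many antichains above it. -/
theorem layeredCount_split_le {α : ℕ} (hα : 2 ≤ α) (r a : ℕ) (L : List ℕ)
    (h : r.choose α ≤ layeredCount α 0 L) :
    layeredCount α α (List.replicate r 1 ++ a :: L) ≤
      layeredCount α α (List.replicate (r + a) 1 ++ L) := by
  rw [List.replicate_add, List.append_assoc, layeredCount_replicate_append hα,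
    layeredCount_replicate_append hα]
  obtain ⟨k, rfl⟩ : ∃ k, α = k + 2 := ⟨α - 2, by omega⟩
  have h₀ : layeredCount (k + 2) 0 (List.replicate a 1 ++ L) = layeredCount (k + 2) 0 L := by
    simp [layeredCount_replicate_append hα]
  have h₁ : ∀ j, layeredCount (k + 2) (j + 1) (a :: L) ≤
      layeredCount (k + 2) (j + 1) (List.replicate a 1 ++ L) := by
    intro j
    rw [layeredCount_replicate_append hα, layeredCount]
    cases j with
    | zero => simp [Finset.Nat.antidiagonal_succ]
    | succ j => simp [Finset.Nat.antidiagonal_succ, ← add_assoc]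
  -- The gain: chains made entirely of the new singletons. The only loss, antichains inside the old
  -- layer above chains of the `r` singletons, is `r.choose α * a.choose α`, which `h` compares with
  -- this gain.
  have h₂ : layeredCount (k + 2) (k + 2) (a :: L) + a.choose (k + 2) * layeredCount (k + 2) 0 L ≤
      layeredCount (k + 2) (k + 2) (List.replicate a 1 ++ L) := by
    rw [layeredCount_replicate_append hα, layeredCount, Finset.Nat.antidiagonal_succ_succ']
    simp only [Finset.sum_cons, Finset.sum_map, Function.Embedding.prodMap, Prod.map,
      Function.Embedding.coeFn_mk, Nat.choose_zero_right, one_mul]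
    have : a * layeredCount (k + 2) (k + 1) L ≤ ∑ x ∈ Finset.HasAntidiagonal.antidiagonal k,
        a.choose (x.1 + 1) * layeredCount (k + 2) (x.2 + 1) L := by
      have := Finset.single_le_sum (f := fun x : ℕ × ℕ =>
        a.choose (x.1 + 1) * layeredCount (k + 2) (x.2 + 1) L) (fun _ _ => Nat.zero_le _)
        (show ((0, k) : ℕ × ℕ) ∈ Finset.HasAntidiagonal.antidiagonal k by simp)
      simpa using this
    simp only [Nat.succ_eq_add_one, show k + 1 + 1 = k + 2 from rfl]
    omega
  rw [Finset.Nat.antidiagonal_succ_succ']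
  simp only [Finset.sum_cons, Finset.sum_map, Function.Embedding.prodMap, Prod.map,
    Function.Embedding.coeFn_mk, Nat.choose_zero_right, one_mul]
  have h₃ : ∑ x ∈ Finset.HasAntidiagonal.antidiagonal k,
        r.choose (x.1 + 1) * layeredCount (k + 2) (x.2 + 1) (a :: L) ≤
      ∑ x ∈ Finset.HasAntidiagonal.antidiagonal k,
        r.choose (x.1 + 1) * layeredCount (k + 2) (x.2 + 1) (List.replicate a 1 ++ L) :=
    Finset.sum_le_sum fun x _ => Nat.mul_le_mul_left _ (h₁ _)
  have h₄ := Nat.mul_le_mul_left (a.choose (k + 2)) h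
  simp only [Nat.succ_eq_add_one] at *
  rw [h₀, layeredCount]
  nlinarith

/-- Each step removes one layer of the list: if the layers above `a` hold at least `r.choose α`
antichains, split `a`; otherwise the top layer has at most `r` elements and can be merged with the
one below it. A single remaining layer gives the product. -/
theorem exists_layeredCount_le {α : ℕ} (hα : 2 ≤ α) (r : ℕ) (L : List ℕ) :
    ∃ p q, p + q = r + L.sum ∧
      layeredCount α α (List.replicate r 1 ++ L) ≤ p.choose α * q.choose α := by
  induction hl : L.length generalizing r L with
  | zero =>
    obtain rfl := List.length_eq_zero_iff.mp hl
    refine ⟨r, 0, by simp, ?_⟩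
    rw [layeredCount_replicate_append hα]
    simp [layeredCount]
  | succ l ih =>
    obtain ⟨a, L, rfl⟩ := List.exists_cons_of_length_eq_add_one hl
    rcases le_or_gt (r.choose α) (layeredCount α 0 L) with h | h
    · obtain ⟨p, q, h₁, h₂⟩ := ih (r + a) L (by simpa using hl)
      exact ⟨p, q, by simp [h₁]; ring, (layeredCount_split_le hα r a L h).trans h₂⟩
    rcases L.eq_nil_or_concat' with rfl | ⟨M, b, rfl⟩
    · refine ⟨r, a, by simp, ?_⟩
      have h₀ : ∀ k s, layeredCount α k (List.replicate s 1) = 0 := fun k s => by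
        simpa [layeredCount] using layeredCount_replicate_append hα s k []
      have h₁ : ∀ k s, listEsymm k (List.replicate s 1) = s.choose k := by
        intro k s
        induction s generalizing k with
        | zero => cases k <;> simp [listEsymm]
        | succ s ih =>
          cases k with
          | zero => simp [listEsymm]
          | succ k => simp [List.replicate_succ, listEsymm, ih, Nat.choose_succ_succ, add_comm]
      rw [layeredCount_append_singleton, h₀, h₁, zero_add]
    · have hb : b ≤ r := by
        by_contra! hbr
        have := Nat.choose_le_choose α hbr.le
        rw [layeredCount_zero_append] at h
        simp [layeredCount] at h
        omega
      obtain ⟨k, rfl⟩ : ∃ k, α = k + 2 := ⟨α - 2, by omega⟩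
      rcases (a :: M).eq_nil_or_concat' with h0 | ⟨Z, c, hZ⟩
      · simp at h0
      · have hs : a + M.sum = Z.sum + c := by simpa using congrArg List.sum hZ
        have hlen : M.length + 1 = Z.length + 1 := by simpa using congrArg List.length hZ
        obtain ⟨p, q, h₁, h₂⟩ := ih r (Z ++ [c + b]) (by simp at hl ⊢; omega)
        refine ⟨p, q, by simp [h₁]; omega, ?_⟩
        rw [← List.cons_append, hZ, List.append_assoc Z]
        rw [← List.append_assoc] at h₂ ⊢
        exact (layeredCount_merge_le k r c b hb Z).trans h₂

/-- The ratio of `(x + 1).choose α` to `x.choose α` decreases in `x`, so moving a unit from the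
larger part to the smaller does not lower the product. -/
theorem choose_mul_choose_le_of_add_eq (α : ℕ) {p q n : ℕ} (h : p + q = n) :
    p.choose α * q.choose α ≤ (n / 2).choose α * (n - n / 2).choose α := by
  have key : ∀ x y : ℕ, y ≤ x →
      (x + 1).choose α * y.choose α ≤ x.choose α * (y + 1).choose α := by
    intro x y hxy
    rcases Nat.lt_or_ge y α with hy | hy
    · simp [Nat.choose_eq_zero_of_lt hy]
    obtain ⟨d, rfl⟩ := Nat.exists_eq_add_of_le hy
    obtain ⟨e, rfl⟩ := Nat.exists_eq_add_of_le hxy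
    have h₁ := Nat.choose_mul_succ_eq (α + d) α
    have h₂ := Nat.choose_mul_succ_eq (α + d + e) α
    rw [show α + d + 1 - α = d + 1 by omega] at h₁
    rw [show α + d + e + 1 - α = d + e + 1 by omega] at h₂
    refine Nat.le_of_mul_le_mul_left (c := (d + e + 1) * (d + 1)) ?_ (by positivity)
    calc (d + e + 1) * (d + 1) * ((α + d + e + 1).choose α * (α + d).choose α)
        = ((α + d + e).choose α * (α + d).choose α) * ((α + d + e + 1) * (d + 1)) := by
          linear_combination (d + 1) * (α + d).choose α * h₂.symm
      _ ≤ ((α + d + e).choose α * (α + d).choose α) * ((d + e + 1) * (α + d + 1)) :=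
          Nat.mul_le_mul_left _ (by nlinarith [Nat.zero_le (α * e)])
      _ = _ := by
          linear_combination (d + e + 1) * (α + d + e).choose α * h₁
  have main : ∀ j p q : ℕ, p + q = n → q ≤ p → p ≤ q + 1 + j →
      p.choose α * q.choose α ≤ (n / 2).choose α * (n - n / 2).choose α := by
    intro j
    induction j with
    | zero =>
      intro p q h₁ h₂ h₃
      rw [show n / 2 = q by omega, show n - q = p by omega, mul_comm]
    | succ j ih =>
      intro p q h₁ h₂ h₃
      rcases Nat.lt_or_ge p (q + 2) with h₄ | h₄
      · exact ih p q h₁ h₂ (by omega)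
      · obtain ⟨x, rfl⟩ : ∃ x, p = x + 1 := ⟨p - 1, by omega⟩
        exact (key x q (by omega)).trans (ih x (q + 1) (by omega) (by omega) (by omega))
  rcases le_total q p with hpq | hpq
  · exact main p p q h hpq (by omega)
  · rw [mul_comm]
    exact main q q p (by omega) hpq (by omega)

end PatternPacking

/-! ### Zykov symmetrization -/

namespace PatternPacking

/-- In the relation `R` pulled back along `φ`, the set `C` is a chain, `B` is an antichain and all
elements of `C` are below all elements of `B`. -/
def IsChainBelowAntichain {V W : Type*} (R : V → V → Prop) (φ : W → V) (C B : Finset W) : Prop :=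
  (∀ x ∈ C, ∀ y ∈ C, x ≠ y → R (φ x) (φ y) ∨ R (φ y) (φ x)) ∧
    (∀ x ∈ B, ∀ y ∈ B, ¬R (φ x) (φ y)) ∧ ∀ x ∈ C, ∀ y ∈ B, R (φ x) (φ y)

open Classical in
/-- The pairs consisting of a `k`-element chain below a `β`-element antichain inside `U`. -/
noncomputable def chainAntichainPairs {V W : Type*} (R : V → V → Prop) (φ : W → V)
    (U : Finset W) (k β : ℕ) : Finset (Finset W × Finset W) :=
  (U.powersetCard k ×ˢ U.powersetCard β).filter fun p => IsChainBelowAntichain R φ p.1 p.2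

theorem mem_chainAntichainPairs {V W : Type*} {R : V → V → Prop} {φ : W → V}
    {U : Finset W} {k β : ℕ} {p : Finset W × Finset W} :
    p ∈ chainAntichainPairs R φ U k β ↔ ((p.1 ⊆ U ∧ p.1.card = k) ∧ (p.2 ⊆ U ∧ p.2.card = β)) ∧
      IsChainBelowAntichain R φ p.1 p.2 := by
  simp [chainAntichainPairs, Finset.mem_powersetCard]

theorem IsChainBelowAntichain.congr {V W : Type*} {R : V → V → Prop} {φ ψ : W → V}
    {C B : Finset W} (h : IsChainBelowAntichain R φ C B)
    (hC : ∀ x ∈ C, ψ x = φ x) (hB : ∀ x ∈ B, ψ x = φ x) : IsChainBelowAntichain R ψ C B := by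
  refine ⟨fun x hx y hy => ?_, fun x hx y hy => ?_, fun x hx y hy => ?_⟩
  · rw [hC x hx, hC y hy]; exact h.1 x hx y hy
  · rw [hB x hx, hB y hy]; exact h.2.1 x hx y hy
  · rw [hC x hx, hB y hy]; exact h.2.2 x hx y hy

theorem IsChainBelowAntichain.map {V W W' : Type*} {R : V → V → Prop} {φ : W → V} {ψ : W' → V}
    {C B : Finset W} (h : IsChainBelowAntichain R φ C B) (f : W ↪ W')
    (hC : ∀ x ∈ C, ψ (f x) = φ x) (hB : ∀ x ∈ B, ψ (f x) = φ x) :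
    IsChainBelowAntichain R ψ (C.map f) (B.map f) := by
  simp only [IsChainBelowAntichain, Finset.forall_mem_map, ne_eq, f.injective.eq_iff]
  exact h.congr (ψ := ψ ∘ f) hC hB

/-- Making `y` a clone of `x` may destroy only pairs using `y` without `x`. Each pair using `x`
without `y` gets a new copy with `x` and `y` swapped. A pair using both has both in the antichain,
by incomparability, and survives. -/
theorem card_chainAntichainPairs_add_le_update {V W : Type*} [Fintype W] [DecidableEq W] {R : V → V → Prop}
    (φ : W → V) (k β : ℕ) {x y : W} (hxy : x ≠ y)
    (h₁ : ¬R (φ x) (φ y)) (h₂ : ¬R (φ y) (φ x)) :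
    (chainAntichainPairs R φ Finset.univ k β).card +
      ((chainAntichainPairs R φ Finset.univ k β).filter
        fun p => x ∈ p.1 ∪ p.2 ∧ y ∉ p.1 ∪ p.2).card ≤
    (chainAntichainPairs R (Function.update φ y (φ x)) Finset.univ k β).card +
      ((chainAntichainPairs R φ Finset.univ k β).filter
        fun p => y ∈ p.1 ∪ p.2 ∧ x ∉ p.1 ∪ p.2).card := by
  set P := chainAntichainPairs R φ Finset.univ k β with hP
  set e : (Finset W × Finset W) ↪ (Finset W × Finset W) :=
    (Finset.mapEmbedding (Equiv.swap x y).toEmbedding).toEmbedding.prodMap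
      (Finset.mapEmbedding (Equiv.swap x y).toEmbedding).toEmbedding with he
  set D := P.filter fun p => y ∈ p.1 ∪ p.2 ∧ x ∉ p.1 ∪ p.2 with hD
  set A := P.filter fun p => x ∈ p.1 ∪ p.2 ∧ y ∉ p.1 ∪ p.2 with hA
  have hsub : (P \ D) ∪ A.map e ⊆
      chainAntichainPairs R (Function.update φ y (φ x)) Finset.univ k β := by
    refine Finset.union_subset ?_ ?_
    · rintro ⟨C, B⟩ hp
      simp only [hD, hP, Finset.mem_sdiff, Finset.mem_filter, mem_chainAntichainPairs,
        Finset.mem_union] at hp ⊢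
      obtain ⟨⟨hc, hocc⟩, hn⟩ := hp
      refine ⟨hc, ?_⟩
      by_cases hy : y ∈ C ∨ y ∈ B
      · have hx : x ∈ C ∨ x ∈ B := by
          by_contra hx
          exact hn ⟨⟨hc, hocc⟩, hy, hx⟩
        obtain ⟨o₁, o₂, o₃⟩ := hocc
        have hyC : y ∉ C := fun hyC => by
          rcases hx with hx | hx
          · rcases o₁ x hx y hyC hxy with h | h
            exacts [h₁ h, h₂ h]
          · exact h₂ (o₃ y hyC x hx)
        have hyB : y ∈ B := hy.resolve_left hyC
        have hxB : x ∈ B := hx.resolve_left fun hx => h₁ (o₃ x hx y hyB)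
        have hCe : ∀ z ∈ C, Function.update φ y (φ x) z = φ z := fun z hz =>
          Function.update_of_ne (fun h : z = y => hyC (h ▸ hz)) _ _
        have hBe : ∀ z ∈ B, ∃ z' ∈ B, Function.update φ y (φ x) z = φ z' := fun z hz => by
          by_cases h : z = y
          · exact ⟨x, hxB, by simp [h]⟩
          · exact ⟨z, hz, Function.update_of_ne h _ _⟩
        refine ⟨fun u hu v hv => ?_, fun u hu v hv => ?_, fun u hu v hv => ?_⟩
        · rw [hCe u hu, hCe v hv]
          exact o₁ u hu v hv
        · obtain ⟨u', hu', hu''⟩ := hBe u hu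
          obtain ⟨v', hv', hv''⟩ := hBe v hv
          rw [hu'', hv'']
          exact o₂ u' hu' v' hv'
        · obtain ⟨v', hv', hv''⟩ := hBe v hv
          rw [hCe u hu, hv'']
          exact o₃ u hu v' hv'
      · push Not at hy
        exact hocc.congr
          (fun z hz => Function.update_of_ne (fun h : z = y => hy.1 (h ▸ hz)) _ _)
          (fun z hz => Function.update_of_ne (fun h : z = y => hy.2 (h ▸ hz)) _ _)
    · intro p hpe
      obtain ⟨⟨C, B⟩, hp, rfl⟩ := Finset.mem_map.mp hpe
      simp only [hA, hP, Finset.mem_filter, mem_chainAntichainPairs, Finset.mem_union] at hp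
      obtain ⟨⟨⟨⟨-, hc₁⟩, -, hc₂⟩, hocc⟩, -, hy⟩ := hp
      push Not at hy
      have hval : ∀ z, z ≠ y → Function.update φ y (φ x) (Equiv.swap x y z) = φ z := by
        intro z hz
        by_cases hzx : z = x
        · simp [hzx]
        · rw [Equiv.swap_apply_of_ne_of_ne hzx hz, Function.update_of_ne hz]
      refine mem_chainAntichainPairs.mpr ⟨⟨⟨Finset.subset_univ _, by simpa [he] using hc₁⟩,
        Finset.subset_univ _, by simpa [he] using hc₂⟩, ?_⟩
      exact hocc.map (Equiv.swap x y).toEmbedding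
        (fun z hz => hval z fun h => hy.1 (h ▸ hz)) (fun z hz => hval z fun h => hy.2 (h ▸ hz))
  have hdisj : Disjoint (P \ D) (A.map e) := by
    rw [Finset.disjoint_right]
    intro p hpe hp'
    obtain ⟨⟨C, B⟩, hp, rfl⟩ := Finset.mem_map.mp hpe
    simp only [hA, Finset.mem_filter, Finset.mem_union] at hp
    simp only [hD, Finset.mem_sdiff, Finset.mem_filter, not_and, not_not] at hp'
    have := hp'.2 hp'.1
    simp only [he, Function.Embedding.prodMap, Function.Embedding.coeFn_mk, Prod.map,
      RelEmbedding.coe_toEmbedding, Finset.mapEmbedding_apply, Finset.mem_union,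
      Finset.mem_map_equiv, Equiv.symm_swap, Equiv.swap_apply_left, Equiv.swap_apply_right] at this
    exact hp.2.2 (this hp.2.1)
  have h := Finset.card_le_card hsub
  rw [Finset.card_union_of_disjoint hdisj, Finset.card_map] at h
  have hD' : (P \ D).card + D.card = P.card := Finset.card_sdiff_add_card_eq_card (Finset.filter_subset _ _ : D ⊆ P)
  omega

/-- Zykov symmetrization: replacing elements by clones of incomparable ones, the number of chains
below antichains can be made maximal by a map whose image is a chain. -/
theorem exists_chain_range_le {W : Type*} [Fintype W] [DecidableEq W] {n : ℕ} {R : Fin n → Fin n → Prop}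
    (φ₀ : W → Fin n) (k β : ℕ) :
    ∃ φ : W → Fin n, (∀ x y, φ x ≠ φ y → R (φ x) (φ y) ∨ R (φ y) (φ x)) ∧
      (chainAntichainPairs R φ₀ Finset.univ k β).card ≤
        (chainAntichainPairs R φ Finset.univ k β).card := by
  set F : (W → Fin n) → ℕ := fun φ => (chainAntichainPairs R φ Finset.univ k β).card with hF
  have : Nonempty (W → Fin n) := ⟨φ₀⟩
  -- The label sum breaks ties: for an incomparable pair, maximality of `F` makes both cloning
  -- directions neutral, but copying the larger label over the smaller one strictly raises the sum.
  obtain ⟨φ, hφ⟩ := Finite.exists_max fun φ : W → Fin n => toLex (F φ, ∑ u, (φ u : ℕ))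
  simp only [Prod.Lex.toLex_le_toLex] at hφ
  have hmax : ∀ ψ, F ψ ≤ F φ := fun ψ => by
    rcases hφ ψ with h | h
    exacts [h.le, h.1.le]
  refine ⟨φ, ?_, hmax φ₀⟩
  have key : ∀ x y, φ y < φ x → R (φ x) (φ y) ∨ R (φ y) (φ x) := by
    intro x y hlt
    by_contra! hR
    have hxy : x ≠ y := fun h => by simp [h] at hlt
    have h₁ := card_chainAntichainPairs_add_le_update φ k β hxy hR.1 hR.2
    have h₂ := card_chainAntichainPairs_add_le_update φ k β hxy.symm hR.2 hR.1
    have h₃ := hmax (Function.update φ x (φ y))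
    have h₄ : ∑ u, (φ u : ℕ) < ∑ u, (Function.update φ y (φ x) u : ℕ) := by
      refine Finset.sum_lt_sum (fun u _ => ?_) ⟨y, Finset.mem_univ _, by simpa using hlt⟩
      by_cases hu : u = y
      · subst hu; simpa using hlt.le
      · simp [Function.update_of_ne hu]
    rcases hφ (Function.update φ y (φ x)) with h | h
    · simp only [hF] at h h₃; omega
    · exact absurd h.2 (not_le.mpr h₄)
  intro x y hne
  rcases lt_or_gt_of_ne hne with h | h
  · exact (key y x h).symm
  · exact key x y h

end PatternPacking

/-! ### From permutations to layered orders, and the extremal value -/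

namespace PatternPacking

/-- Peel off the fibre of a minimal label: everything else lies above it. A chain meets this fibre
at most once, a nonempty chain forces the antichain out of it, and an antichain meeting it stays
inside it. -/
theorem card_chainAntichainPairs_le {V W : Type*} [Finite V] [DecidableEq W]
    {R : V → V → Prop} (hirr : ∀ v, ¬R v v) (htrans : ∀ u v w, R u v → R v w → R u w)
    (φ : W → V) {β : ℕ} (hβ : 1 ≤ β) (U : Finset W)
    (hU : ∀ x ∈ U, ∀ y ∈ U, φ x ≠ φ y → R (φ x) (φ y) ∨ R (φ y) (φ x)) :
    ∃ L : List ℕ, L.sum = U.card ∧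
      ∀ k, (chainAntichainPairs R φ U k β).card ≤ layeredCount β k L := by
  classical
  induction U using Finset.strongInduction with
  | H U ih =>
  rcases U.eq_empty_or_nonempty with rfl | hne
  · refine ⟨[], rfl, fun k => ?_⟩
    simp only [layeredCount, nonpos_iff_eq_zero, Finset.card_eq_zero]
    refine Finset.eq_empty_of_forall_notMem fun p hp => ?_
    obtain ⟨⟨-, h, h'⟩, -⟩ := mem_chainAntichainPairs.mp hp
    rw [Finset.subset_empty.mp h, Finset.card_empty] at h'
    omega
  have : IsTrans V R := ⟨htrans⟩
  have : Std.Irrefl R := ⟨hirr⟩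
  obtain ⟨v, hv, hmin⟩ := (Finite.wellFounded_of_trans_of_irrefl R).has_min
    (φ '' U) ((Finset.coe_nonempty.mpr hne).image φ)
  obtain ⟨x₀, hx₀, rfl⟩ := hv
  set U₀ := U.filter fun y => φ y = φ x₀ with hU₀
  set U₁ := U.filter fun y => ¬φ y = φ x₀ with hU₁
  have hsub : U₁ ⊆ U := Finset.filter_subset _ _
  have hlow : ∀ y ∈ U, ¬R (φ y) (φ x₀) := fun y hy => hmin _ ⟨y, hy, rfl⟩
  have habove : ∀ y ∈ U₁, R (φ x₀) (φ y) := fun y hy => by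
    obtain ⟨hy, hne⟩ := Finset.mem_filter.mp hy
    exact (hU y hy x₀ hx₀ hne).resolve_left (hlow y hy)
  have hmem : ∀ y ∈ U, φ y ≠ φ x₀ → y ∈ U₁ := fun y hy h => Finset.mem_filter.mpr ⟨hy, h⟩
  obtain ⟨L, hL, hcount⟩ := ih U₁
    (Finset.filter_ssubset.mpr ⟨x₀, hx₀, by simp⟩)
    fun x hx y hy => hU x (hsub hx) y (hsub hy)
  have hcard : U₀.card + U₁.card = U.card := Finset.card_filter_add_card_filter_not _
  refine ⟨U₀.card :: L, by simp [hL, hcard], fun k => ?_⟩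
  cases k with
  | zero =>
    have h : chainAntichainPairs R φ U 0 β ⊆
        (U₀.powersetCard β).image (fun B => ((∅ : Finset W), B)) ∪
          chainAntichainPairs R φ U₁ 0 β := by
      rintro ⟨C, B⟩ hp
      obtain ⟨⟨⟨-, hC⟩, hB, hB'⟩, hocc⟩ := mem_chainAntichainPairs.mp hp
      obtain rfl := Finset.card_eq_zero.mp hC
      by_cases h : ∃ b ∈ B, φ b = φ x₀
      · obtain ⟨b, hb, hbx⟩ := h
        refine Finset.mem_union_left _ (Finset.mem_image.mpr
          ⟨B, Finset.mem_powersetCard.mpr ⟨fun c hc => ?_, hB'⟩, rfl⟩)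
        refine Finset.mem_filter.mpr ⟨hB hc, ?_⟩
        by_contra hcx
        exact hocc.2.1 b hb c hc (hbx ▸ habove c (hmem c (hB hc) hcx))
      · push Not at h
        exact Finset.mem_union_right _ (mem_chainAntichainPairs.mpr
          ⟨⟨⟨by simp, hC⟩, fun c hc => hmem c (hB hc) (h c hc), hB'⟩, hocc⟩)
    calc _ ≤ _ := Finset.card_le_card h
      _ ≤ _ := Finset.card_union_le _ _
      _ ≤ U₀.card.choose β + layeredCount β 0 L := by
        gcongr
        · exact Finset.card_image_le.trans (Finset.card_powersetCard _ _).le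
        · exact hcount 0
  | succ k =>
    have h : chainAntichainPairs R φ U (k + 1) β ⊆ chainAntichainPairs R φ U₁ (k + 1) β ∪
        (U₀ ×ˢ chainAntichainPairs R φ U₁ k β).image
          (fun q => (insert q.1 q.2.1, q.2.2)) := by
      rintro ⟨C, B⟩ hp
      obtain ⟨⟨⟨hC, hC'⟩, hB, hB'⟩, o₁, o₂, o₃⟩ := mem_chainAntichainPairs.mp hp
      simp only at hC hC' hB hB' o₁ o₂ o₃
      obtain ⟨c₀, hc₀⟩ : C.Nonempty := Finset.card_pos.mp (by omega)
      have hB₁ : B ⊆ U₁ := fun b hb => hmem b (hB hb) fun hbx =>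
        hlow c₀ (hC hc₀) (hbx ▸ o₃ c₀ hc₀ b hb)
      by_cases h : ∃ c ∈ C, φ c = φ x₀
      · obtain ⟨c, hc, hcx⟩ := h
        refine Finset.mem_union_right _ (Finset.mem_image.mpr ⟨(c, (C.erase c, B)),
          Finset.mem_product.mpr ⟨Finset.mem_filter.mpr ⟨hC hc, hcx⟩,
            mem_chainAntichainPairs.mpr ⟨⟨⟨fun d hd => ?_, ?_⟩, hB₁, hB'⟩, ?_⟩⟩, ?_⟩)
        · obtain ⟨hdc, hd⟩ := Finset.mem_erase.mp hd
          refine hmem d (hC hd) fun hdx => ?_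
          have := o₁ d hd c hc hdc
          rw [hdx, hcx] at this
          exact this.elim (hirr _) (hirr _)
        · simp [Finset.card_erase_of_mem hc, hC']
        · exact ⟨fun x hx y hy => o₁ x (Finset.mem_of_mem_erase hx) y (Finset.mem_of_mem_erase hy),
            o₂, fun x hx y hy => o₃ x (Finset.mem_of_mem_erase hx) y hy⟩
        · simp [Finset.insert_erase hc]
      · push Not at h
        exact Finset.mem_union_left _ (mem_chainAntichainPairs.mpr
          ⟨⟨⟨fun c hc => hmem c (hC hc) (h c hc), hC'⟩, hB₁, hB'⟩, o₁, o₂, o₃⟩)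
    calc _ ≤ _ := Finset.card_le_card h
      _ ≤ _ := Finset.card_union_le _ _
      _ ≤ layeredCount β (k + 1) L + U₀.card * layeredCount β k L := by
        gcongr
        · exact hcount (k + 1)
        · refine Finset.card_image_le.trans ?_
          rw [Finset.card_product]
          exact Nat.mul_le_mul_left _ (hcount k)

/-- The first `α` positions of an occurrence form the chain and the last `β` the antichain; their
union recovers the occurrence. -/
theorem occ_tau_le_card_chainAntichainPairs {n : ℕ} (α β : ℕ) (σ : Equiv.Perm (Fin n)) :
    occ (tau α β) σ ≤ (chainAntichainPairs (fun i j : Fin n => i < j ∧ σ i < σ j) id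
      Finset.univ α β).card := by
  classical
  set C : Finset (Fin n) → Finset (Fin n) := fun S =>
    if h : S.card = α + β then
      Finset.univ.map ((Fin.castAddEmb β).trans (S.orderEmbOfFin h).toEmbedding) else ∅ with hC
  set B : Finset (Fin n) → Finset (Fin n) := fun S =>
    if h : S.card = α + β then
      Finset.univ.map ((Fin.natAddEmb α).trans (S.orderEmbOfFin h).toEmbedding) else ∅ with hB
  refine Finset.card_le_card_of_injOn (fun S => (C S, B S)) ?_ ?_
  · intro S hS
    obtain ⟨h, hocc⟩ := (Finset.mem_filter.mp hS).2
    refine mem_chainAntichainPairs.mpr ⟨by simp [hC, hB, h], ?_⟩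
    simp only [hC, hB, h, dite_true, IsChainBelowAntichain, Finset.forall_mem_map,
      Function.Embedding.trans_apply, RelEmbedding.coe_toEmbedding, Finset.mem_univ, forall_const,
      hocc, OrderEmbedding.lt_iff_lt, Fin.castAddEmb_apply, Fin.natAddEmb_apply, id,
      tau_castAdd, tau_natAdd]
    refine ⟨fun i j hij => ?_, fun i j => ?_, fun i j => ?_⟩
    · have : i ≠ j := fun h => hij (by rw [h])
      simp only [Fin.lt_def, Fin.val_castAdd]
      omega
    · simp only [Fin.lt_def, Fin.val_natAdd, Fin.val_rev]
      omega
    · simp only [Fin.lt_def, Fin.val_natAdd, Fin.val_castAdd]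
      omega
  · have hunion : ∀ S ∈ Finset.univ.filter (fun S => IsOccurrence (tau α β) σ S),
        C S ∪ B S = S := by
      intro S hS
      obtain ⟨h, -⟩ := (Finset.mem_filter.mp hS).2
      simp only [hC, hB, h, dite_true]
      conv_rhs => rw [← Finset.map_orderEmbOfFin_univ S h]
      ext x
      simp only [Finset.mem_union, Finset.mem_map, Finset.mem_univ, true_and]
      refine ⟨?_, ?_⟩
      · rintro (⟨i, rfl⟩ | ⟨i, rfl⟩)
        exacts [⟨_, rfl⟩, ⟨_, rfl⟩]
      · rintro ⟨i, rfl⟩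
        refine Fin.addCases (fun i => ?_) (fun i => ?_) i
        exacts [Or.inl ⟨i, rfl⟩, Or.inr ⟨i, rfl⟩]
    intro S hS T hT hST
    simp only [Prod.mk.injEq] at hST
    rw [← hunion S (by simpa using hS), ← hunion T (by simpa using hT), hST.1, hST.2]

theorem maxOcc_tau_le {α : ℕ} (hα : 2 ≤ α) (n : ℕ) :
    maxOcc (tau α α) n ≤ (n / 2).choose α * (n - n / 2).choose α := by
  refine Finset.sup_le fun σ _ => ?_
  have hirr : ∀ v : Fin n, ¬(v < v ∧ σ v < σ v) := fun v h => lt_irrefl v h.1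
  obtain ⟨φ, hφ, hle⟩ := exists_chain_range_le (R := fun i j : Fin n => i < j ∧ σ i < σ j)
    id α α
  obtain ⟨L, hL, hcount⟩ := card_chainAntichainPairs_le (R := fun i j : Fin n => i < j ∧ σ i < σ j)
    hirr
    (fun u v w h h' => ⟨h.1.trans h'.1, h.2.trans h'.2⟩) φ (by omega : 1 ≤ α) Finset.univ
    fun x _ y _ => hφ x y
  obtain ⟨p, q, hpq, hbound⟩ := exists_layeredCount_le hα 0 L
  refine (occ_tau_le_card_chainAntichainPairs α α σ).trans (hle.trans ((hcount α).trans ?_))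
  exact hbound.trans (choose_mul_choose_le_of_add_eq α (by simp [hpq, hL]))

theorem isOccurrence_of_strictMono {m n : ℕ} {τ : Equiv.Perm (Fin m)} {σ : Equiv.Perm (Fin n)}
    {S : Finset (Fin n)} {f : Fin m → Fin n} (hS : S.card = m) (hf : StrictMono f)
    (hfS : ∀ i, f i ∈ S) (h : ∀ i j, σ (f i) < σ (f j) ↔ τ i < τ j) : IsOccurrence τ σ S := by
  refine ⟨hS, ?_⟩
  rw [← Finset.orderEmbOfFin_unique hS hfS hf]
  exact h

/-- Any `α` of the singleton layers together with any `β` elements of the top layer form an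
occurrence. -/
theorem choose_mul_choose_le_occ_tau (α β p q : ℕ) :
    p.choose α * q.choose β ≤ occ (tau α β) (tau p q) := by
  classical
  have hcard : ((Finset.univ : Finset (Fin p)).powersetCard α ×ˢ
      (Finset.univ : Finset (Fin q)).powersetCard β).card = p.choose α * q.choose β := by simp
  rw [← hcard]
  have hdisj : ∀ (C : Finset (Fin p)) (B : Finset (Fin q)),
      Disjoint (C.map (Fin.castAddEmb q)) (B.map (Fin.natAddEmb p)) := by
    intro C B
    simp only [Finset.disjoint_left, Finset.mem_map, Fin.castAddEmb_apply, Fin.natAddEmb_apply]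
    rintro _ ⟨c, -, rfl⟩ ⟨b, -, h⟩
    simp only [Fin.ext_iff, Fin.val_natAdd, Fin.val_castAdd] at h
    omega
  have hlt : ∀ {a b : ℕ} (i : Fin a) (j : Fin b), Fin.castAdd b i < Fin.natAdd a j := by
    intro a b i j
    simp only [Fin.lt_def, Fin.val_castAdd, Fin.val_natAdd]
    omega
  have hnlt : ∀ {a b : ℕ} (i : Fin a) (j : Fin b), ¬Fin.natAdd a j < Fin.castAdd b i :=
    fun i j => (hlt i j).not_gt
  have hne : ∀ {a b : ℕ} (i : Fin a) (j : Fin b), Fin.castAdd b i ≠ Fin.natAdd a j :=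
    fun i j => (hlt i j).ne
  have hcast : ∀ {a b : ℕ} (i j : Fin a), Fin.castAdd b i < Fin.castAdd b j ↔ i < j :=
    fun _ _ => Iff.rfl
  refine Finset.card_le_card_of_injOn
    (fun x => x.1.map (Fin.castAddEmb q) ∪ x.2.map (Fin.natAddEmb p)) ?_ ?_
  · rintro ⟨C, B⟩ hx
    simp only [Finset.coe_product, Set.mem_prod, Finset.mem_coe, Finset.mem_powersetCard,
      Finset.subset_univ, true_and] at hx
    obtain ⟨hC, hB⟩ := hx
    simp only [Finset.coe_filter, Finset.mem_univ, true_and, Set.mem_ofPred_eq]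
    refine isOccurrence_of_strictMono
      (f := Fin.addCases (fun i => Fin.castAdd q (C.orderEmbOfFin hC i))
        (fun j => Fin.natAdd p (B.orderEmbOfFin hB j))) ?_ ?_ ?_ ?_
    · rw [Finset.card_union_of_disjoint (hdisj C B)]
      simp [hC, hB]
    · intro i j
      refine Fin.addCases (fun i => ?_) (fun i => ?_) i <;>
        refine Fin.addCases (fun j => ?_) (fun j => ?_) j <;>
        simp [hlt, hnlt, hcast]
    · intro i
      refine Fin.addCases (fun i => ?_) (fun i => ?_) i <;> simp
    · intro i j
      refine Fin.addCases (fun i => ?_) (fun i => ?_) i <;>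
        refine Fin.addCases (fun j => ?_) (fun j => ?_) j <;>
        simp [tau_castAdd, tau_natAdd, hlt, hnlt, hcast]
  · rintro ⟨C, B⟩ - ⟨C', B'⟩ - h
    simp only [Finset.ext_iff, Finset.mem_union, Finset.mem_map, Fin.castAddEmb_apply,
      Fin.natAddEmb_apply] at h
    refine Prod.ext (Finset.ext fun c => ?_) (Finset.ext fun b => ?_)
    · have := h (Fin.castAdd q c)
      simpa [(hne _ _).symm] using this
    · have := h (Fin.natAdd p b)
      simpa [hne] using this

theorem maxOcc_tau {α : ℕ} (hα : 2 ≤ α) (n : ℕ) :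
    maxOcc (tau α α) n = (n / 2).choose α * (n - n / 2).choose α := by
  refine le_antisymm (maxOcc_tau_le hα n) ?_
  have h : ∀ p q, p.choose α * q.choose α ≤ maxOcc (tau α α) (p + q) := fun p q =>
    (choose_mul_choose_le_occ_tau α α p q).trans
      (Finset.le_sup (f := fun σ => occ (tau α α) σ) (Finset.mem_univ (tau p q)))
  have := h (n / 2) (n - n / 2)
  rwa [Nat.add_sub_cancel' (Nat.div_le_self n 2)] at this

end PatternPacking

/-! ### Asymptotics -/

namespace PatternPacking

theorem tendsto_choose_div_pow (k : ℕ) :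
    Tendsto (fun n : ℕ => (n.choose k : ℝ) / (n : ℝ) ^ k) atTop (𝓝 (1 / (k.factorial : ℝ))) := by
  have h := (isEquivalent_choose k).div
    (Asymptotics.IsEquivalent.refl (u := fun n : ℕ => (n : ℝ) ^ k) (l := atTop))
  refine h.symm.tendsto_nhds (tendsto_const_nhds.congr' ?_)
  filter_upwards [eventually_gt_atTop 0] with n hn
  have : (n : ℝ) ^ k ≠ 0 := by positivity
  simp only [Pi.div_apply]
  field_simp

theorem tendsto_choose_mul_choose_div_choose (α : ℕ) {u v N : ℕ → ℕ} (hN : Tendsto N atTop atTop)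
    (hu : Tendsto u atTop atTop) (hv : Tendsto v atTop atTop)
    (hu' : Tendsto (fun n => (u n : ℝ) / N n) atTop (𝓝 (1 / 2)))
    (hv' : Tendsto (fun n => (v n : ℝ) / N n) atTop (𝓝 (1 / 2))) :
    Tendsto (fun n => ((u n).choose α : ℝ) * (v n).choose α / (N n).choose (2 * α)) atTop
      (𝓝 (((2 * α).choose α : ℝ) / 2 ^ (2 * α))) := by
  have hf : ∀ k : ℕ, (k.factorial : ℝ) ≠ 0 := fun k => mod_cast k.factorial_ne_zero
  have h₁ := (((tendsto_choose_div_pow α).comp hu).mul (hu'.pow α)).mul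
    (((tendsto_choose_div_pow α).comp hv).mul (hv'.pow α))
  have h₂ := h₁.div ((tendsto_choose_div_pow (2 * α)).comp hN) (one_div_ne_zero (hf _))
  have hlim : 1 / (α.factorial : ℝ) * (1 / 2) ^ α * (1 / (α.factorial : ℝ) * (1 / 2) ^ α) /
      (1 / ((2 * α).factorial : ℝ)) = ((2 * α).choose α : ℝ) / 2 ^ (2 * α) := by
    rw [Nat.cast_choose ℝ (show α ≤ 2 * α by omega), show 2 * α - α = α by omega]
    have := hf α
    have := hf (2 * α)
    rw [one_div_pow, mul_comm 2 α, pow_mul]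
    field_simp
  rw [hlim] at h₂
  refine h₂.congr' ?_
  filter_upwards [hN.eventually_gt_atTop 0, hu.eventually_gt_atTop 0,
    hv.eventually_gt_atTop 0] with n hn hun hvn
  have h₃ : (N n : ℝ) ≠ 0 := by positivity
  have h₄ : (u n : ℝ) ≠ 0 := by positivity
  have h₅ : (v n : ℝ) ≠ 0 := by positivity
  simp only [Function.comp_apply, Pi.div_apply, div_pow, two_mul, pow_add]
  field_simp

theorem tendsto_half_div : Tendsto (fun n : ℕ => ((n / 2 : ℕ) : ℝ) / n) atTop (𝓝 (1 / 2)) := by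
  have h := (tendsto_nat_floor_mul_div_atTop (R := ℝ) (a := 1 / 2) (by norm_num)).comp
    (tendsto_natCast_atTop_atTop (R := ℝ))
  refine h.congr fun n => ?_
  simp only [Function.comp_apply]
  rw [one_div, inv_mul_eq_div, ← Nat.floor_div_eq_div (K := ℝ)]
  norm_num

end PatternPacking

theorem mainTheorem2 (α : ℕ) (hα : 2 ≤ α) :
    Tendsto (PatternPacking.packingRatio (PatternPacking.tau α α)) atTop
      (𝓝 (PatternPacking.packingDensity (PatternPacking.tau α α))) ∧
    PatternPacking.packingDensity (PatternPacking.tau α α) =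
      ((2 * α).choose α : ℝ) / 2 ^ (2 * α) ∧
    (∀ n : ℕ, PatternPacking.maxOcc (PatternPacking.tau α α) (2 * n) = n.choose α ^ 2) ∧
    Tendsto (fun n : ℕ => (n.choose α : ℝ) ^ 2 / ((2 * n).choose (2 * α) : ℝ)) atTop
      (𝓝 (PatternPacking.packingDensity (PatternPacking.tau α α))) := by
  have heven : ∀ n : ℕ, PatternPacking.maxOcc (PatternPacking.tau α α) (2 * n) =
      n.choose α ^ 2 := fun n => by
    rw [PatternPacking.maxOcc_tau hα, show 2 * n / 2 = n by omega, show 2 * n - n = n by omega, sq]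
  have hdouble : Tendsto (fun n : ℕ => 2 * n) atTop atTop :=
    tendsto_id.const_mul_atTop' (by norm_num)
  have hhalf : Tendsto (fun n : ℕ => n / 2) atTop atTop :=
    Nat.tendsto_div_const_atTop (by norm_num)
  have hlim : Tendsto (PatternPacking.packingRatio (PatternPacking.tau α α)) atTop
      (𝓝 (((2 * α).choose α : ℝ) / 2 ^ (2 * α))) := by
    have h := PatternPacking.tendsto_choose_mul_choose_div_choose α (u := fun n => n / 2)
      (v := fun n => n - n / 2) (N := fun n => n) tendsto_id hhalf
      (tendsto_atTop_mono (fun n => by omega) hhalf) PatternPacking.tendsto_half_div ?_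
    · refine h.congr fun n => ?_
      rw [PatternPacking.packingRatio, PatternPacking.maxOcc_tau hα, two_mul]
      push_cast
      rfl
    · have h := PatternPacking.tendsto_half_div.const_sub 1
      rw [show (1 : ℝ) - 1 / 2 = 1 / 2 by norm_num] at h
      refine h.congr' ?_
      filter_upwards [eventually_gt_atTop 0] with n hn
      have : (n : ℝ) ≠ 0 := by positivity
      rw [Nat.cast_sub (Nat.div_le_self n 2), sub_div, div_self this]
  -- `limUnder` carries information only once convergence is known, so `hlim` has to come first.
  have hρ : PatternPacking.packingDensity (PatternPacking.tau α α) =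
      ((2 * α).choose α : ℝ) / 2 ^ (2 * α) := hlim.limUnder_eq
  refine ⟨hρ ▸ hlim, hρ, heven, ?_⟩
  rw [hρ]
  refine (hlim.comp hdouble).congr fun n => ?_
  simp only [Function.comp_apply, PatternPacking.packingRatio, heven]
  rw [two_mul α]
  push_cast
  rfl
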